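/- All signatures and relational structures are finite. For structures $\mathbf A,\mathbf B$ of the same signature, write $\mathbf A\to\mathbf B$ if there is a homomorphism from $\mathbf A$ to $\mathbf B$; a PCSP template is a pair $(\mathbf S,\mathbf T)$ of structures of the same signature with $\mathbf S\to\mathbf T$. $\mathrm{Pol}(\mathbf S,\mathbf T)$ is the set of polymorphisms of $(\mathbf S,\mathbf T)$, an $m$-ary polymorphism being a homomorphism $\mathbf S^m\to\mathbf T$. A function $g$ of arity $m$ is a weak near unanimity function (WNU) if $g(y,x,\dots,x)=g(x,y,x,\dots,x)=\cdots=g(x,\dots,x,y)$ for all $x,y$ in its base domain. A partial homomorphism from $\mathbf I$ to $\mathbf S$ is a homomorphism to $\mathbf S$ from the substructure of $\mathbf I$ induced by some subset $X$ of the domain $I$ of $\mathbf I$. A $k$-strategy on $\mathbf I$ and $\mathbf S$ is a nonempty set $\mathcal H$ of partial homomorphisms from $\mathbf I$ to $\mathbf S$ that is closed under restrictions and such that for every $h\in\mathcal H$ with $|\mathrm{dom}(h)|<k$ and every $x\in I\setminus\mathrm{dom}(h)$ there is an extension $f\in\mathcal H$ of $h$ with $\mathrm{dom}(f)=\mathrm{dom}(h)\cup\{x\}$.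 Write $\mathbf I\le_k\mathbf S$ if a $k$-strategy on $\mathbf I$ and $\mathbf S$ exists. A template $(\mathbf S,\mathbf T)$ has width $k(n)$ if for every structure $\mathbf I$ of its signature, with $n$ the number of elements of $\mathbf I$, $\mathbf I\le_{k(n)}\mathbf S$ implies $\mathbf I\to\mathbf T$. It has bounded width if it has width $k(n)$ for some $k(n)=O(1)$, and sublinear width if it has width $k(n)$ for some $k(n)=o(n)$. **Lemma.** There is a PCSP template $(\mathbf S,\mathbf T)$ that has neither sublinear width nor bounded width, such that $\mathrm{Pol}(\mathbf S,\mathbf T)$ contains a WNU of arity $m$ for every $m\ge 3$. (So containing WNUs of all arities $m\ge3$ does not imply sublinear or bounded width.) Concretely, this holds for the following $\mathbf S$ and $\mathbf T$, both with domain $\{0,1\}$ and a single $4$-ary relation: the relation of $\mathbf S$ (2-in-4-SAT) consists of all tuples with exactly two $1$'s, and the relation of $\mathbf T$ (4-NAE-SAT) consists of all tuples except $(0,0,0,0)$ and $(1,1,1,1)$. For every $m\ge 3$, a WNU of arity $m$ in $\mathrm{Pol}(\mathbf S,\mathbf T)$ is given by the function $h:\{0,1\}^m\to\{0,1\}$ with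 $$h(x_1,\dots,x_m)=\begin{cases}a&\text{if } |\{i : x_i=a\}|>m/2 \text{ for some } a\in\{0,1\},\\ x_1&\text{otherwise.}\end{cases}$$ -/

import Mathlib

namespace PCSP

/-- A finite relational signature: finitely many relation symbols, each with an arity. -/
structure Signature where
  Symbol : Type
  [finite : Finite Symbol]
  arity : Symbol → ℕ

/-- A finite relational structure of signature `σ`. -/
structure RelStructure (σ : Signature) where
  carrier : Type
  [finite : Finite carrier]
  rel : (R : σ.Symbol) → Set (Fin (σ.arity R) → carrier)

attribute [instance] Signature.finite RelStructure.finite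

variable {σ : Signature}

/-- `f` is a homomorphism from `A` to `B`. -/
def IsHom (A B : RelStructure σ) (f : A.carrier → B.carrier) : Prop :=
  ∀ (R : σ.Symbol) (t : Fin (σ.arity R) → A.carrier),
    t ∈ A.rel R → (fun i => f (t i)) ∈ B.rel R

/-- There is a homomorphism from `A` to `B`. -/
def Maps (A B : RelStructure σ) : Prop :=
  ∃ f : A.carrier → B.carrier, IsHom A B f

/-- `(S, T)` is a PCSP template. -/
def IsTemplate (S T : RelStructure σ) : Prop :=
  Maps S T

/-- The `n`-th power of a structure. -/
def RelStructure.power (A : RelStructure σ) (n : ℕ) : RelStructure σ where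
  carrier := Fin n → A.carrier
  rel R := {t | ∀ i : Fin n, (fun j => t j i) ∈ A.rel R}

/-- The set of `n`-ary polymorphisms of `(A, B)`: the homomorphisms from `A ^ n` to `B`. -/
def Pol (A B : RelStructure σ) (n : ℕ) : Set ((Fin n → A.carrier) → B.carrier) :=
  {f | IsHom (A.power n) B f}

/-- `g` is a weak near unanimity function:
`g(y,x,…,x) = g(x,y,x,…,x) = ⋯ = g(x,…,x,y)` for all `x` and `y`. -/
def IsWNU {α β : Type} {m : ℕ} (g : (Fin m → α) → β) : Prop :=
  ∀ (x y : α) (i j : Fin m),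
    g (Function.update (fun _ => x) i y) = g (Function.update (fun _ => x) j y)

/-- The substructure of `A` induced by a subset `X` of its domain. -/
def RelStructure.induced (A : RelStructure σ) (X : Set A.carrier) : RelStructure σ where
  carrier := X
  rel R := {t | (fun i => (t i : A.carrier)) ∈ A.rel R}

/-- A map from a subset of `α` to `β`. -/
structure PartialMap (α β : Type) where
  dom : Set α
  toFun : dom → β

/-- The restriction of a partial map to a subset of its domain. -/
def PartialMap.restrict {α β : Type} (h : PartialMap α β) (X : Set α) (hX : X ⊆ h.dom) :
    PartialMap α β where
  dom := X
  toFun x := h.toFun ⟨x, hX x.2⟩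

/-- The partial map `f` is an extension of the partial map `h`. -/
def PartialMap.Extends {α β : Type} (f h : PartialMap α β) : Prop :=
  ∃ hX : h.dom ⊆ f.dom, f.restrict h.dom hX = h

/-- `h` is a partial homomorphism from `I` to `S`. -/
def IsPartialHom (I S : RelStructure σ) (h : PartialMap I.carrier S.carrier) : Prop :=
  IsHom (I.induced h.dom) S h.toFun

/-- `H` is a `k`-strategy on `I` and `S`. -/
structure IsStrategy (k : ℕ) (I S : RelStructure σ)
    (H : Set (PartialMap I.carrier S.carrier)) : Prop where
  nonempty : H.Nonempty
  partialHom : ∀ h ∈ H, IsPartialHom I S h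
  restrict_mem : ∀ h ∈ H, ∀ (X : Set I.carrier) (hX : X ⊆ h.dom), h.restrict X hX ∈ H
  extension : ∀ h ∈ H, h.dom.ncard < k → ∀ x ∉ h.dom,
    ∃ f ∈ H, f.Extends h ∧ f.dom = insert x h.dom

/-- `I ≤ₖ S`: there is a `k`-strategy on `I` and `S`. -/
def Consistent (k : ℕ) (I S : RelStructure σ) : Prop :=
  ∃ H : Set (PartialMap I.carrier S.carrier), IsStrategy k I S H

/-- `(S, T)` has width `k(n)`: for every instance `I` with `n` elements, `I ≤_{k(n)} S`
implies `I → T`. -/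
def HasWidth (S T : RelStructure σ) (k : ℕ → ℕ) : Prop :=
  ∀ I : RelStructure σ, Consistent (k (Nat.card I.carrier)) I S → Maps I T

/-- `(S, T)` has width `k(n)` for some `k(n) = O(1)`. -/
def HasBoundedWidth (S T : RelStructure σ) : Prop :=
  ∃ k : ℕ → ℕ,
    (fun n => (k n : ℝ)) =O[Filter.atTop] (fun _ => (1 : ℝ)) ∧ HasWidth S T k

/-- `(S, T)` has width `k(n)` for some `k(n) = o(n)`. -/
def HasSublinearWidth (S T : RelStructure σ) : Prop :=
  ∃ k : ℕ → ℕ,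
    (fun n => (k n : ℝ)) =o[Filter.atTop] (fun n => (n : ℝ)) ∧ HasWidth S T k

/-- The signature with a single relation symbol, of arity `r`. -/
def singleSig (r : ℕ) : Signature where
  Symbol := Unit
  arity _ := r

/-- The structure `s`-in-`r`-SAT on `{0, 1}`: its relation of arity `r` holds the tuples with
exactly `s` many ones. -/
def exactlyIn (s r : ℕ) : RelStructure (singleSig r) where
  carrier := Fin 2
  rel _ := {t : Fin r → Fin 2 | (Finset.univ.filter fun i => t i = 1).card = s}

/-- The structure `r`-NAE-SAT on `{0, 1}`: its relation of arity `r` holds all tuples except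
`(0,…,0)` and `(1,…,1)`. -/
def nae (r : ℕ) : RelStructure (singleSig r) where
  carrier := Fin 2
  rel _ := {t : Fin r → Fin 2 | t ≠ (fun _ => 0) ∧ t ≠ (fun _ => 1)}

/-- The function that returns the strict majority value of its arguments if there is one, and
the first argument in case of a tie. -/
def majorityOrFirst (m : ℕ) (hm : 0 < m) (x : Fin m → Fin 2) : Fin 2 :=
  if m < 2 * (Finset.univ.filter fun i => x i = 0).card then 0
  else if m < 2 * (Finset.univ.filter fun i => x i = 1).card then 1
  else x ⟨0, hm⟩

end PCSP

namespace PCSP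

open Finset

/-! ### The polymorphisms -/

/-! WNUs: every column of a matrix with columns in 2-in-4-SAT is balanced. If all four rows were
sent to `a`, double counting would make each row a tie, so the first column would be constant
(`majorityOrFirst_mem_pol`).

Width: take `12 * n` random 4-ary constraints on `n` vertices. With positive probability every
2-colouring makes some constraint constant, so there is no homomorphism to 4-NAE-SAT, and yet any
`s` constraints with `0 < s ≤ 4 * k` cover more than `11 * s / 4` vertices, where `k` is a constant
fraction of `n` (`exists_expanding_not_colourable`). Such expansion yields a `k`-strategy
(`consistent_ofConstraints`): a minimal set of constraints incompatible with a partial assignment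
has few vertices that occur only once in it, hence a small support, and expansion then forces it to
have fewer than `2 * k` members. So no sublinear width suffices, and bounded width is a special case
of sublinear width. -/

theorem isTemplate_exactlyIn_nae : IsTemplate (exactlyIn 2 4) (nae 4) := by
  refine ⟨fun x => x, fun _ (t : Fin 4 → Fin 2) ht => ?_⟩
  change (univ.filter fun i => t i = (1 : Fin 2)).card = 2 at ht
  refine ⟨fun h => ?_, fun h => ?_⟩ <;>
  · have h' : ∀ i, t i = _ := fun i => congrFun h i
    simp only [h'] at ht
    revert ht
    decide

theorem card_filter_zero_add_card_filter_one {m : ℕ} (x : Fin m → Fin 2) :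
    (univ.filter fun i => x i = 0).card + (univ.filter fun i => x i = 1).card = m := by
  have h := card_filter_add_card_filter_not (s := (univ : Finset (Fin m))) (fun i => x i = 0)
  have h2 : (univ.filter fun i => ¬ x i = 0) = univ.filter fun i => x i = 1 := by
    ext i
    simp only [mem_filter, mem_univ, true_and]
    omega
  rw [h2] at h
  simpa using h

theorem le_two_mul_card_filter_majorityOrFirst {m : ℕ} (hm : 0 < m) (x : Fin m → Fin 2) :
    m ≤ 2 * (univ.filter fun i => x i = majorityOrFirst m hm x).card := by
  have h := card_filter_zero_add_card_filter_one x
  unfold majorityOrFirst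
  split_ifs with h0 h1
  · omega
  · omega
  · generalize x ⟨0, hm⟩ = a
    fin_cases a <;> simp <;> omega

theorem majorityOrFirst_of_tie {m : ℕ} (hm : 0 < m) (x : Fin m → Fin 2) {a : Fin 2}
    (h : 2 * (univ.filter fun i => x i = a).card = m) :
    majorityOrFirst m hm x = x ⟨0, hm⟩ := by
  have h' := card_filter_zero_add_card_filter_one x
  have : 2 * (univ.filter fun i => x i = 0).card = m := by
    fin_cases a <;> simp at h <;> omega
  unfold majorityOrFirst
  rw [if_neg (by omega), if_neg (by omega)]

theorem majorityOrFirst_of_lt {m : ℕ} (hm : 0 < m) (x : Fin m → Fin 2) {a : Fin 2}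
    (h : m < 2 * (univ.filter fun i => x i = a).card) :
    majorityOrFirst m hm x = a := by
  have h' := card_filter_zero_add_card_filter_one x
  unfold majorityOrFirst
  obtain rfl | rfl : a = 0 ∨ a = 1 := by omega
  · rw [if_pos h]
  · rw [if_neg (by omega), if_pos h]

/-- For `m ≥ 3` the `m - 1` equal arguments are a strict majority, wherever the odd one stands. -/
theorem isWNU_majorityOrFirst {m : ℕ} (hm : 3 ≤ m) (hm' : 0 < m) :
    IsWNU (majorityOrFirst m hm') := by
  have key : ∀ (x y : Fin 2) (i : Fin m),
      majorityOrFirst m hm' (Function.update (fun _ => x) i y) = x := by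
    intro x y i
    apply majorityOrFirst_of_lt
    have : univ.erase i ⊆ univ.filter fun j => Function.update (fun _ => x) i y j = x := by
      intro j hj
      simp [Function.update_of_ne (ne_of_mem_erase hj)]
    have := card_le_card this
    rw [card_erase_of_mem (mem_univ i), card_univ, Fintype.card_fin] at this
    omega
  intro x y i j
  rw [key, key]

/-- A column of a tuple in 2-in-4-SAT takes either value exactly twice. -/
theorem card_filter_eq_two {t : Fin 4 → Fin 2} (ht : (univ.filter fun i => t i = 1).card = 2)
    (a : Fin 2) : (univ.filter fun i => t i = a).card = 2 := by
  have h := card_filter_zero_add_card_filter_one t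
  fin_cases a
  · simp
    omega
  · simpa using ht

theorem majorityOrFirst_mem_pol {m : ℕ} (hm : 0 < m) :
    majorityOrFirst m hm ∈ Pol (exactlyIn 2 4) (nae 4) m := by
  rintro R (t : Fin 4 → Fin m → Fin 2) ht
  have hcol : ∀ (i : Fin m) (a : Fin 2), (univ.filter fun j => t j i = a).card = 2 :=
    fun i a => card_filter_eq_two (ht i) a
  have key : ∀ a : Fin 2, ¬ ∀ j, majorityOrFirst m hm (t j) = a := by
    intro a h
    have hrow : ∀ j ∈ univ, m ≤ 2 * (univ.filter fun i => t j i = a).card := fun j _ => by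
      simpa [h j] using le_two_mul_card_filter_majorityOrFirst hm (t j)
    -- Counted by columns, `a` occurs `2 * m` times, which is the least that four rows with at least
    -- `m / 2` occurrences each allow. So every row is a tie.
    have hsum : ∑ j : Fin 4, 2 * (univ.filter fun i => t j i = a).card = ∑ j : Fin 4, m := by
      rw [← mul_sum]
      have : ∑ j : Fin 4, (univ.filter fun i => t j i = a).card =
          ∑ i : Fin m, (univ.filter fun j => t j i = a).card := by
        simp only [card_filter]
        exact sum_comm
      rw [this]
      simp [hcol]
      ring
    have htie := (sum_eq_sum_iff_of_le hrow).1 hsum.symm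
    have h0 := hcol ⟨0, hm⟩ a
    rw [filter_true_of_mem] at h0
    · simp at h0
    · intro j _
      rw [← h j, majorityOrFirst_of_tie hm (t j) (htie j (mem_univ j)).symm]
  exact ⟨fun h => key 0 fun j => congrFun h j, fun h => key 1 fun j => congrFun h j⟩

/-! ### Strategies on expanding instances -/

theorem Consistent.anti {σ : Signature} {I S : RelStructure σ} {k l : ℕ} (h : Consistent l I S)
    (hkl : k ≤ l) : Consistent k I S := by
  obtain ⟨H, hH⟩ := h
  exact ⟨H, hH.nonempty, hH.partialHom, hH.restrict_mem,
    fun f hf hk => hH.extension f hf (hk.trans_le hkl)⟩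

/-- The image of `T` is large only if many elements of `T` do not collide with any other one. -/
theorem two_mul_card_image_le {α β : Type*} [DecidableEq α] [DecidableEq β] (f : α → β)
    (T : Finset α) :
    2 * (T.image f).card ≤ T.card + (T.filter fun a => ∀ b ∈ T, f b = f a → b = a).card := by
  set P := T.filter fun a => ∀ b ∈ T, f b = f a → b = a with hP
  have h1 := card_eq_sum_card_fiberwise (f := f) (s := T) (t := T.image f)
    (fun a ha => mem_image_of_mem f ha)
  have h2 := card_eq_sum_card_fiberwise (f := f) (s := P) (t := T.image f)
    (fun a ha => mem_image_of_mem f (mem_filter.1 ha).1)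
  rw [h1, h2, ← sum_add_distrib, mul_comm, ← smul_eq_mul]
  -- Each fibre contributes at least 2: a singleton counts once in `T` and once in `P`, a larger
  -- fibre at least twice in `T`.
  refine card_nsmul_le_sum _ _ _ fun v hv => ?_
  obtain ⟨a, ha, rfl⟩ := mem_image.1 hv
  have ha' : a ∈ T.filter fun b => f b = f a := by simp [ha]
  have hpos : 0 < (T.filter fun b => f b = f a).card := card_pos.2 ⟨a, ha'⟩
  by_cases h : (T.filter fun b => f b = f a).card = 1
  · have : 0 < (P.filter fun b => f b = f a).card := by
      refine card_pos.2 ⟨a, ?_⟩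
      simp only [hP, mem_filter, and_true]
      refine ⟨ha, fun b hb hba => ?_⟩
      obtain ⟨c, hc⟩ := card_eq_one.1 h
      rw [hc, mem_singleton] at ha'
      have hb' : b ∈ T.filter fun b => f b = f a := by simp [hb, hba]
      rw [hc, mem_singleton] at hb'
      rw [ha', hb']
    omega
  · omega

open Classical in
/-- The partial map that agrees with `h` on its domain and maps `x` to `a` if `h` is not defined
there. -/
noncomputable def PartialMap.adjoin {α β : Type} (h : PartialMap α β) (x : α) (a : β) :
    PartialMap α β where
  dom := insert x h.dom
  toFun y := if hy : (y : α) ∈ h.dom then h.toFun ⟨y, hy⟩ else a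

theorem PartialMap.adjoin_extends {α β : Type} (h : PartialMap α β) (x : α) (a : β) :
    (h.adjoin x a).Extends h := by
  refine ⟨Set.subset_insert x h.dom, ?_⟩
  obtain ⟨X, f⟩ := h
  simp only [PartialMap.restrict, PartialMap.adjoin, PartialMap.mk.injEq, heq_eq_eq, true_and]
  funext y
  simp

section Expansion

variable {V ι : Type} (E : ι → Fin 4 → V)

/-- The vertices that occur in a set of constraints. -/
def support [DecidableEq V] (F : Finset ι) : Finset V := (F ×ˢ univ).image fun p => E p.1 p.2

/-- The partial assignment `h` extends to one that satisfies the constraints in `F`. -/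
def Extendable (h : PartialMap V (Fin 2)) (F : Finset ι) : Prop :=
  ∃ g : V → Fin 2, (∀ x : h.dom, g x = h.toFun x) ∧
    ∀ e ∈ F, (univ.filter fun i => g (E e i) = 1).card = 2

variable {E}

/-- The other two positions hold 0, 1 or 2 ones, and two free bits can supply the rest. -/
theorem exists_update_update_card_eq_two :
    ∀ (i j : Fin 4), i ≠ j → ∀ t : Fin 4 → Fin 2, ∃ a b,
      (univ.filter fun l => Function.update (Function.update t i a) j b l = 1).card = 2 := by
  decide

/-- Two free positions of a constraint suffice to satisfy it. -/
theorem Extendable.of_erase [DecidableEq ι] {h : PartialMap V (Fin 2)} {F : Finset ι} {e : ι} {i j : Fin 4}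
    (hF : Extendable E h (F.erase e)) (hij : i ≠ j)
    (hi : E e i ∉ h.dom) (hj : E e j ∉ h.dom)
    (hi' : ∀ e' ∈ F, ∀ l, E e' l = E e i → e' = e ∧ l = i)
    (hj' : ∀ e' ∈ F, ∀ l, E e' l = E e j → e' = e ∧ l = j) : Extendable E h F := by
  classical
  obtain ⟨g, hg, hs⟩ := hF
  obtain ⟨a, b, hab⟩ := exists_update_update_card_eq_two i j hij fun l => g (E e l)
  -- Both vertices occur nowhere else in `F`, so overwriting `g` there affects only positions `i`
  -- and `j` of `e`.
  refine ⟨Function.update (Function.update g (E e i) a) (E e j) b, fun x => ?_, fun e' he' => ?_⟩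
  · have h1 : (x : V) ≠ E e i := fun hx => hi (hx ▸ x.2)
    have h2 : (x : V) ≠ E e j := fun hx => hj (hx ▸ x.2)
    rw [Function.update_of_ne h2, Function.update_of_ne h1, hg]
  · by_cases hee : e' = e
    · subst hee
      refine Eq.trans (congrArg card ?_) hab
      refine filter_congr fun l _ => ?_
      have : Function.update (Function.update g (E e' i) a) (E e' j) b (E e' l) =
          Function.update (Function.update (fun l => g (E e' l)) i a) j b l := by
        by_cases hlj : l = j
        · subst hlj
          simp
        · rw [Function.update_of_ne hlj,
            Function.update_of_ne fun hl => hlj (hj' e' he' l hl).2]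
          by_cases hli : l = i
          · subst hli
            simp
          · rw [Function.update_of_ne hli,
              Function.update_of_ne fun hl => hli (hi' e' he' l hl).2]
      rw [this]
    · refine Eq.trans (congrArg card ?_) (hs e' (mem_erase.2 ⟨hee, he'⟩))
      refine filter_congr fun l _ => ?_
      rw [Function.update_of_ne fun hl => hee (hj' e' he' l hl).1,
        Function.update_of_ne fun hl => hee (hi' e' he' l hl).1]

/-- A minimal set of constraints that is incompatible with `h` has a small support. -/
theorem two_mul_card_support_le [DecidableEq V] [DecidableEq ι] [Finite V] {h : PartialMap V (Fin 2)} {F : Finset ι}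
    (hF : ¬ Extendable E h F) (hmin : ∀ e ∈ F, Extendable E h (F.erase e)) :
    2 * (support E F).card ≤ 5 * F.card + h.dom.ncard := by
  classical
  have hfin : h.dom.Finite := Set.toFinite _
  set T : Finset (ι × Fin 4) := F ×ˢ univ with hT
  set f : ι × Fin 4 → V := fun p => E p.1 p.2 with hf
  have h1 := two_mul_card_image_le f T
  set P := T.filter fun a => ∀ b ∈ T, f b = f a → b = a with hP
  have hPpriv : ∀ p ∈ P, p.1 ∈ F ∧ ∀ e' ∈ F, ∀ l, E e' l = E p.1 p.2 → e' = p.1 ∧ l = p.2 := by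
    intro p hp
    simp only [hP, hT, mem_filter, mem_product, mem_univ, and_true] at hp
    refine ⟨hp.1, fun e' he' l hl => ?_⟩
    have := hp.2 (e', l) he' hl
    exact ⟨congrArg Prod.fst this, congrArg Prod.snd this⟩
  have hin : (P.filter fun p => f p ∈ h.dom).card ≤ h.dom.ncard := by
    rw [Set.ncard_eq_toFinset_card _ hfin]
    refine card_le_card_of_injOn f (fun p hp => ?_) fun p hp q hq hpq => ?_
    · simpa using (mem_filter.1 hp).2
    · have hq' := (mem_filter.1 (mem_filter.1 hq).1).2
      exact hq' p (mem_filter.1 (mem_filter.1 hp).1).1 hpq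
  -- A constraint with two private positions outside `h.dom` could always be satisfied last,
  -- contrary to minimality.
  have hout : (P.filter fun p => ¬ f p ∈ h.dom).card ≤ F.card := by
    refine card_le_card_of_injOn Prod.fst (fun p hp => ?_) fun p hp q hq hpq => ?_
    · exact (hPpriv p (mem_filter.1 hp).1).1
    · obtain ⟨e, i⟩ := p
      obtain ⟨e', j⟩ := q
      obtain rfl : e = e' := hpq
      by_contra hne
      have hij : i ≠ j := fun hij => hne (by rw [hij])
      obtain ⟨hp1, hp2⟩ := mem_filter.1 hp
      obtain ⟨hq1, hq2⟩ := mem_filter.1 hq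
      exact hF ((hmin e (hPpriv _ hp1).1).of_erase hij hp2 hq2 (hPpriv _ hp1).2 (hPpriv _ hq1).2)
  have h2 := card_filter_add_card_filter_not (s := P) (fun p => f p ∈ h.dom)
  have h3 : T.card = F.card * 4 := by simp [hT]
  have h4 : support E F = T.image f := rfl
  rw [h4]
  omega

theorem exists_subset_minimal_not_extendable [DecidableEq ι] {h : PartialMap V (Fin 2)} {F : Finset ι}
    (hF : ¬ Extendable E h F) :
    ∃ G ⊆ F, ¬ Extendable E h G ∧ ∀ e ∈ G, Extendable E h (G.erase e) := by
  induction F using Finset.strongInduction with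
  | H F ih =>
    by_cases hmin : ∀ e ∈ F, Extendable E h (F.erase e)
    · exact ⟨F, Subset.rfl, hF, hmin⟩
    · push Not at hmin
      obtain ⟨e, he, hFe⟩ := hmin
      obtain ⟨G, hG, h1, h2⟩ := ih _ (erase_ssubset he) hFe
      exact ⟨G, hG.trans (erase_subset _ _), h1, h2⟩

/-- If small sets of constraints expand then the sets of constraints that are incompatible with
`h` have small incompatible subsets. -/
theorem exists_subset_card_le_not_extendable [DecidableEq V] [Finite V] {r k : ℕ}
    (hE : ∀ F : Finset ι, F.Nonempty → F.card ≤ r → 11 * F.card < 4 * (support E F).card)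
    {h : PartialMap V (Fin 2)} (hk : h.dom.ncard ≤ k)
    {F : Finset ι} (hF : ¬ Extendable E h F) (hFr : F.card ≤ r) :
    ∃ G, G.card < 2 * k ∧ ¬ Extendable E h G := by
  classical
  obtain ⟨G, hGF, h1, h2⟩ := exists_subset_minimal_not_extendable hF
  refine ⟨G, ?_, h1⟩
  have h3 := two_mul_card_support_le h1 h2
  obtain rfl | hne := G.eq_empty_or_nonempty
  · exfalso
    exact h1 ⟨fun x => if hx : x ∈ h.dom then h.toFun ⟨x, hx⟩ else 0, fun x => by simp,
      by simp⟩
  -- Expansion and `h3` give `11 * G.card < 10 * G.card + 2 * k`.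
  · have := hE G hne ((card_le_card hGF).trans hFr)
    omega

/-- The instance with domain `V` and constraints `E`. -/
def ofConstraints [Finite V] (E : ι → Fin 4 → V) : RelStructure (singleSig 4) where
  carrier := V
  rel _ := Set.range E

/-- The strategy consists of the assignments on at most `k` vertices that are compatible with any `4
* k` constraints. If neither value at `x` were allowed, the two obstructions, each of size below `2
* k`, would together form an obstruction to `h` itself; this is where `4 * k` comes from. -/
theorem consistent_ofConstraints [DecidableEq V] [Finite V] {k : ℕ} (hk : 0 < k)
    (hE : ∀ F : Finset ι, F.Nonempty → F.card ≤ 4 * k → 11 * F.card < 4 * (support E F).card) :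
    Consistent k (ofConstraints E) (exactlyIn 2 4) := by
  classical
  refine ⟨{h | h.dom.ncard ≤ k ∧ ∀ F : Finset ι, F.card ≤ 4 * k → Extendable (V := V) E h F},
    ⟨⟨∅, fun x => x.2.elim⟩, ?_, fun F hF => ?_⟩, ?_, ?_, ?_⟩
  · exact (Set.ncard_empty V).trans_le k.zero_le
  · by_contra hne
    -- For the empty assignment the size bound is `2 * 0`, which no obstruction meets.
    obtain ⟨G, hG, -⟩ := exists_subset_card_le_not_extendable (k := 0) hE
      (Set.ncard_empty V).le hne hF
    omega
  · rintro (h : PartialMap V (Fin 2)) ⟨-, hh⟩ R (t : Fin 4 → h.dom) ⟨e, he⟩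
    obtain ⟨g, hg, hs⟩ := hh {e} (by simp; omega)
    have := hs e (mem_singleton_self e)
    change (univ.filter fun i => h.toFun (t i) = 1).card = 2
    refine Eq.trans (congrArg card (filter_congr fun i _ => ?_)) this
    rw [← hg (t i), he]
  · rintro (h : PartialMap V (Fin 2)) ⟨hk, hh⟩ (X : Set V) hX
    refine ⟨(Set.ncard_le_ncard hX (Set.toFinite (α := V) _)).trans hk, fun F hF => ?_⟩
    obtain ⟨g, hg, hs⟩ := hh F hF
    exact ⟨g, fun x => hg ⟨x, hX x.2⟩, hs⟩
  · rintro (h : PartialMap V (Fin 2)) ⟨-, hh⟩ hlt (x : V) hx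
    have hcard : ∀ a, (h.adjoin x a).dom.ncard ≤ k :=
      fun a => (Set.ncard_insert_le (α := V) _ _).trans hlt
    by_contra hcon
    have hbad : ∀ a, ∃ G : Finset ι, G.card < 2 * k ∧ ¬ Extendable E (h.adjoin x a) G := by
      intro a
      have : ¬ ∀ F : Finset ι, F.card ≤ 4 * k → Extendable E (h.adjoin x a) F := fun hF =>
        hcon ⟨h.adjoin x a, ⟨hcard a, hF⟩, h.adjoin_extends x a, rfl⟩
      push Not at this
      obtain ⟨F, hF, hF'⟩ := this
      exact exists_subset_card_le_not_extendable hE (hcard a) hF' hF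
    choose G hG hG' using hbad
    obtain ⟨g, hg, hs⟩ := hh (G 0 ∪ G 1) (by
      have := card_union_le (G 0) (G 1)
      have := hG 0
      have := hG 1
      omega)
    -- `g` itself picks a value at `x`, and so contradicts the obstruction for that value.
    refine hG' (g x) ⟨g, ?_, fun e he => hs e ?_⟩
    · rintro ⟨y, hy⟩
      by_cases hyd : y ∈ h.dom
      · simpa [PartialMap.adjoin, hyd] using hg ⟨y, hyd⟩
      · obtain rfl : y = x := hy.resolve_right hyd
        simp [PartialMap.adjoin, hyd]
    · generalize g x = a at he
      fin_cases a
      · exact mem_union_left _ he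
      · exact mem_union_right _ he

end Expansion

/-! ### Random instances -/

/-- Combines `n.choose r ≤ n ^ r / r!` with `r ^ r / r! ≤ e ^ r` and `e < 3`. -/
theorem choose_le_three_mul_div_pow (n : ℕ) {r : ℕ} (hr : 0 < r) :
    (n.choose r : ℝ) ≤ (3 * n / r) ^ r := by
  have hr' : (0 : ℝ) < (r : ℝ) ^ r := by positivity
  have hf : (0 : ℝ) < (r.factorial : ℝ) := by positivity
  have h1 : (n.choose r : ℝ) ≤ (n : ℝ) ^ r / r.factorial := Nat.choose_le_pow_div r n
  have h2 : (r : ℝ) ^ r / r.factorial ≤ 3 ^ r := by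
    refine (Real.pow_div_factorial_le_exp (r : ℝ) (by positivity) r).trans ?_
    rw [← mul_one (r : ℝ), Real.exp_nat_mul]
    exact pow_le_pow_left₀ (Real.exp_pos 1).le Real.exp_one_lt_three.le r
  rw [div_le_iff₀ hf] at h2
  refine h1.trans ?_
  rw [div_pow, mul_pow, div_le_div_iff₀ hf hr']
  calc (n : ℝ) ^ r * (r : ℝ) ^ r ≤ (n : ℝ) ^ r * (3 ^ r * r.factorial) := by gcongr
    _ = 3 ^ r * (n : ℝ) ^ r * r.factorial := by ring

/-- The union bound for sets of `s` constraints with a support of at most `11 * s / 4` elements. -/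
theorem choose_mul_choose_mul_pow_le {n s : ℕ} (hs : 0 < s) (hn : 3 * s * 11664 ^ 4 ≤ n) :
    ((12 * n).choose s : ℝ) * (n.choose (11 * s / 4)) * ((11 * s / 4 : ℕ) / n : ℝ) ^ (4 * s) ≤
      (1 / 4) ^ s := by
  obtain ⟨v, hv⟩ : ∃ v, v = 11 * s / 4 := ⟨_, rfl⟩
  -- `q` is `s / 4` rounded up, so `4 * s = v + (s + q)`: the power `v` cancels against the choice
  -- of the vertices, the power `s` against that of the constraints, and the surplus `q` gives the
  -- decay. The constant is `11664 = 4 * (36 * 27 * 3)`, which leaves `1 / 4` per constraint.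
  obtain ⟨q, hq⟩ : ∃ q, q = (s + 3) / 4 := ⟨_, rfl⟩
  rw [← hv]
  have hv0 : 0 < v := by omega
  have hn0 : 0 < n := by omega
  have hsR : (0 : ℝ) < s := by exact_mod_cast hs
  have hvR : (0 : ℝ) < v := by exact_mod_cast hv0
  have hnR : (0 : ℝ) < n := by exact_mod_cast hn0
  have hv3 : (v : ℝ) ≤ 3 * s := by
    have : v ≤ 3 * s := by omega
    exact_mod_cast this
  have h1 : ((12 * n).choose s : ℝ) ≤ (36 * n / s) ^ s := by
    refine (choose_le_three_mul_div_pow (12 * n) hs).trans (le_of_eq ?_)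
    push_cast
    ring
  have h2 : (n.choose v : ℝ) * (v / n : ℝ) ^ v ≤ 27 ^ s := by
    calc (n.choose v : ℝ) * (v / n : ℝ) ^ v ≤ (3 * n / v) ^ v * (v / n : ℝ) ^ v := by
          gcongr
          exact choose_le_three_mul_div_pow n hv0
      _ = 3 ^ v := by
          rw [← mul_pow]
          congr 1
          field_simp
      _ ≤ 3 ^ (3 * s) := pow_le_pow_right₀ (by norm_num) (by omega)
      _ = 27 ^ s := by
          rw [pow_mul]
          norm_num
  have h3 : (3 * s / n : ℝ) ≤ (1 / 11664) ^ 4 := by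
    have : ((3 * s * 11664 ^ 4 : ℕ) : ℝ) ≤ n := by exact_mod_cast hn
    push_cast at this
    rw [div_le_iff₀ hnR]
    linarith
  have h4 : (3 * s / n : ℝ) ^ q ≤ (1 / 11664) ^ s := by
    calc (3 * s / n : ℝ) ^ q ≤ ((1 / 11664) ^ 4) ^ q := by gcongr
      _ = (1 / 11664) ^ (4 * q) := (pow_mul _ _ _).symm
      _ ≤ (1 / 11664) ^ s := pow_le_pow_of_le_one (by norm_num) (by norm_num) (by omega)
  have h5 : (v / n : ℝ) ^ (s + q) ≤ (3 * s / n) ^ s * (1 / 11664) ^ s := by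
    calc (v / n : ℝ) ^ (s + q) ≤ (3 * s / n) ^ (s + q) := by gcongr
      _ = (3 * s / n) ^ s * (3 * s / n) ^ q := pow_add _ _ _
      _ ≤ _ := by gcongr
  calc ((12 * n).choose s : ℝ) * (n.choose v) * (v / n : ℝ) ^ (4 * s)
      = (12 * n).choose s * ((n.choose v) * (v / n : ℝ) ^ v) * (v / n : ℝ) ^ (s + q) := by
        rw [show 4 * s = v + (s + q) by omega, pow_add]
        ring
    _ ≤ (36 * n / s) ^ s * 27 ^ s * ((3 * s / n) ^ s * (1 / 11664) ^ s) := by gcongr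
    _ = (1 / 4) ^ s := by
        rw [← mul_pow, ← mul_pow, ← mul_pow]
        congr 1
        field_simp
        norm_num

theorem sum_Icc_one_quarter_pow_le (r : ℕ) : ∑ s ∈ Icc 1 r, (1 / 4 : ℝ) ^ s ≤ 1 / 3 := by
  have : ∑ s ∈ Icc 1 r, (1 / 4 : ℝ) ^ s = 1 / 3 - (1 / 3) * (1 / 4) ^ r := by
    induction r with
    | zero => simp
    | succ r ih =>
      rw [sum_Icc_succ_top (by omega), ih]
      ring
  rw [this]
  linarith [show (0 : ℝ) ≤ 1 / 3 * (1 / 4) ^ r by positivity]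

variable {n m : ℕ}

/-- The number of sequences of constraints for which the constraints in `F` lie in `W`. -/
theorem card_filter_forall_mem (F : Finset (Fin m)) (W : Finset (Fin n)) :
    (univ.filter fun E : Fin m → Fin 4 → Fin n => ∀ e ∈ F, ∀ i, E e i ∈ W).card =
      (W.card ^ 4) ^ F.card * (n ^ 4) ^ (m - F.card) := by
  have : (univ.filter fun E : Fin m → Fin 4 → Fin n => ∀ e ∈ F, ∀ i, E e i ∈ W) =
      Fintype.piFinset fun e => if e ∈ F then Fintype.piFinset (fun _ : Fin 4 => W) else univ := by
    ext E
    simp only [mem_filter, mem_univ, true_and, Fintype.mem_piFinset]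
    refine forall_congr' fun e => ?_
    split_ifs with he <;> simp [he]
  rw [this, Fintype.card_piFinset]
  have : ∀ e : Fin m,
      (if e ∈ F then Fintype.piFinset (fun _ : Fin 4 => W) else univ).card =
        if e ∈ F then W.card ^ 4 else n ^ 4 := by
    intro e
    split_ifs <;> simp
  simp_rw [this]
  rw [prod_ite, prod_const, prod_const, filter_not]
  simp [card_sdiff]

theorem card_filter_forall_mem_eq_mul (hn : 0 < n) (F : Finset (Fin m)) (W : Finset (Fin n)) :
    ((univ.filter fun E : Fin m → Fin 4 → Fin n => ∀ e ∈ F, ∀ i, E e i ∈ W).card : ℝ) =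
      (W.card / n : ℝ) ^ (4 * F.card) * (n ^ 4) ^ m := by
  have hF : F.card ≤ m := by simpa using card_le_univ F
  have hnR : (n : ℝ) ≠ 0 := by positivity
  rw [card_filter_forall_mem]
  push_cast
  rw [← pow_sub_mul_pow _ hF, pow_mul, div_pow, div_pow]
  field_simp

/-- Most sequences of constraints expand. -/
theorem card_filter_not_expanding_le {r : ℕ} (hn0 : 0 < n) (hn : 3 * r * 11664 ^ 4 ≤ n) :
    ((univ.filter fun E : Fin (12 * n) → Fin 4 → Fin n =>
      ∃ F : Finset (Fin (12 * n)), F.Nonempty ∧ F.card ≤ r ∧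
        4 * (support E F).card ≤ 11 * F.card).card : ℝ) ≤ 1 / 3 * (n ^ 4) ^ (12 * n) := by
  classical
  set A : Finset (Fin (12 * n)) → Finset (Fin n) → Finset (Fin (12 * n) → Fin 4 → Fin n) :=
    fun F W => univ.filter fun E => ∀ e ∈ F, ∀ i, E e i ∈ W with hA
  set B : ℕ → Finset (Fin (12 * n) → Fin 4 → Fin n) := fun s =>
    (powersetCard s univ ×ˢ powersetCard (11 * s / 4) univ).biUnion fun p => A p.1 p.2 with hB
  have hsub : (univ.filter fun E : Fin (12 * n) → Fin 4 → Fin n =>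
      ∃ F : Finset (Fin (12 * n)), F.Nonempty ∧ F.card ≤ r ∧
        4 * (support E F).card ≤ 11 * F.card) ⊆ (Icc 1 r).biUnion B := by
    intro E hE
    obtain ⟨F, hF, hFr, hcard⟩ := (mem_filter.1 hE).2
    -- Enlarging the support to a fixed size lets the union bound range over sets `W` of one
    -- cardinality for each `s`.
    obtain ⟨W, hW, -, hWc⟩ := exists_subsuperset_card_eq (subset_univ (support E F))
      (n := 11 * F.card / 4) (by omega) (by
        rw [card_univ, Fintype.card_fin]
        omega)
    refine mem_biUnion.2 ⟨F.card, mem_Icc.2 ⟨hF.card_pos, hFr⟩, mem_biUnion.2 ⟨(F, W), ?_, ?_⟩⟩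
    · simp [mem_powersetCard, hWc]
    · simp only [hA, mem_filter, mem_univ, true_and]
      intro e he i
      exact hW (mem_image.2 ⟨(e, i), by simp [he], rfl⟩)
  have hBc : ∀ s ∈ Icc 1 r, ((B s).card : ℝ) ≤ (1 / 4) ^ s * (n ^ 4) ^ (12 * n) := by
    intro s hs
    obtain ⟨hs1, hsr⟩ := mem_Icc.1 hs
    have h1 : ((B s).card : ℝ) ≤ ∑ p ∈ powersetCard s (univ : Finset (Fin (12 * n))) ×ˢ
        powersetCard (11 * s / 4) (univ : Finset (Fin n)), ((A p.1 p.2).card : ℝ) := by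
      exact_mod_cast card_biUnion_le
    have h2 : ∀ p ∈ powersetCard s (univ : Finset (Fin (12 * n))) ×ˢ
        powersetCard (11 * s / 4) (univ : Finset (Fin n)), ((A p.1 p.2).card : ℝ) =
        ((11 * s / 4 : ℕ) / n : ℝ) ^ (4 * s) * (n ^ 4) ^ (12 * n) := by
      intro p hp
      obtain ⟨hp1, hp2⟩ := mem_product.1 hp
      rw [hA, card_filter_forall_mem_eq_mul hn0, (mem_powersetCard.1 hp1).2,
        (mem_powersetCard.1 hp2).2]
    rw [sum_congr rfl h2, sum_const, card_product, card_powersetCard, card_powersetCard,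
      card_univ, card_univ, Fintype.card_fin, Fintype.card_fin, nsmul_eq_mul, ← mul_assoc] at h1
    push_cast at h1
    refine h1.trans (mul_le_mul_of_nonneg_right ?_ (by positivity))
    have := choose_mul_choose_mul_pow_le (n := n) hs1
      (le_trans (Nat.mul_le_mul_right _ (Nat.mul_le_mul_left 3 hsr)) hn)
    exact this
  calc _ ≤ (((Icc 1 r).biUnion B).card : ℝ) := by exact_mod_cast card_le_card hsub
    _ ≤ ∑ s ∈ Icc 1 r, ((B s).card : ℝ) := by exact_mod_cast card_biUnion_le
    _ ≤ ∑ s ∈ Icc 1 r, (1 / 4 : ℝ) ^ s * (n ^ 4) ^ (12 * n) := sum_le_sum hBc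
    _ = (∑ s ∈ Icc 1 r, (1 / 4 : ℝ) ^ s) * (n ^ 4) ^ (12 * n) := (sum_mul _ _ _).symm
    _ ≤ _ := by
      gcongr
      exact sum_Icc_one_quarter_pow_le r

/-- A colouring is proper on at most `7 / 8` of all tuples. -/
theorem card_filter_proper_le (c : Fin n → Fin 2) :
    ((univ.filter fun t : Fin 4 → Fin n =>
      (∃ i, c (t i) ≠ 0) ∧ ∃ i, c (t i) ≠ 1).card : ℝ) ≤ 7 / 8 * n ^ 4 := by
  classical
  set A : Finset (Fin 4 → Fin n) := Fintype.piFinset fun _ => univ.filter fun x => c x = 0 with hA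
  set B : Finset (Fin 4 → Fin n) := Fintype.piFinset fun _ => univ.filter fun x => c x = 1 with hB
  set P : Finset (Fin 4 → Fin n) := univ.filter fun t : Fin 4 → Fin n =>
      (∃ i, c (t i) ≠ 0) ∧ ∃ i, c (t i) ≠ 1 with hP
  have hdisj : Disjoint P (A ∪ B) := by
    rw [disjoint_left]
    intro t ht hAB
    obtain ⟨⟨i, hi⟩, j, hj⟩ := (mem_filter.1 ht).2
    rcases mem_union.1 hAB with h | h
    · exact hi (by simpa using Fintype.mem_piFinset.1 h i)
    · exact hj (by simpa using Fintype.mem_piFinset.1 h j)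
  have hdisj' : Disjoint A B := by
    rw [disjoint_left]
    intro t ht hB
    have h0 : c (t 0) = 0 := by simpa using Fintype.mem_piFinset.1 ht 0
    have h1 : c (t 0) = 1 := by simpa using Fintype.mem_piFinset.1 hB 0
    rw [h0] at h1
    exact absurd h1 (by decide)
  have hcard : P.card + (A.card + B.card) ≤ n ^ 4 := by
    rw [← card_union_of_disjoint hdisj', ← card_union_of_disjoint hdisj]
    simpa using card_le_univ (P ∪ (A ∪ B))
  have hsum := card_filter_zero_add_card_filter_one c
  rw [hA, hB, Fintype.card_piFinset_const, Fintype.card_piFinset_const] at hcard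
  generalize (univ.filter fun x => c x = 0).card = a at hcard hsum
  generalize (univ.filter fun x => c x = 1).card = b at hcard hsum
  subst hsum
  have hcardR : (P.card : ℝ) + ((a : ℝ) ^ 4 + (b : ℝ) ^ 4) ≤ ((a : ℝ) + b) ^ 4 := by
    exact_mod_cast hcard
  push_cast
  -- Applying the quadratic mean inequality twice gives `(a + b) ^ 4 ≤ 8 * (a ^ 4 + b ^ 4)`.
  have h2 : ((a : ℝ) + b) ^ 2 ≤ 2 * ((a : ℝ) ^ 2 + (b : ℝ) ^ 2) := add_sq_le
  have h4 : ((a : ℝ) ^ 2 + (b : ℝ) ^ 2) ^ 2 ≤ 2 * (((a : ℝ) ^ 2) ^ 2 + ((b : ℝ) ^ 2) ^ 2) :=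
    add_sq_le
  have h5 : (((a : ℝ) + b) ^ 2) ^ 2 ≤ (2 * ((a : ℝ) ^ 2 + (b : ℝ) ^ 2)) ^ 2 :=
    pow_le_pow_left₀ (by positivity) h2 2
  nlinarith

/-- Most sequences of constraints have no proper colouring. -/
theorem card_filter_colourable_le (hn0 : 0 < n) :
    ((univ.filter fun E : Fin (12 * n) → Fin 4 → Fin n => ∃ c : Fin n → Fin 2,
      ∀ e, (∃ i, c (E e i) ≠ 0) ∧ ∃ i, c (E e i) ≠ 1).card : ℝ) ≤
        1 / 2 * (n ^ 4) ^ (12 * n) := by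
  classical
  set P : (Fin n → Fin 2) → Finset (Fin 4 → Fin n) := fun c =>
    univ.filter fun t : Fin 4 → Fin n => (∃ i, c (t i) ≠ 0) ∧ ∃ i, c (t i) ≠ 1 with hP
  have hsub : (univ.filter fun E : Fin (12 * n) → Fin 4 → Fin n => ∃ c : Fin n → Fin 2,
      ∀ e, (∃ i, c (E e i) ≠ 0) ∧ ∃ i, c (E e i) ≠ 1) ⊆
      univ.biUnion fun c => Fintype.piFinset fun _ => P c := by
    intro E hE
    obtain ⟨c, hc⟩ := (mem_filter.1 hE).2
    exact mem_biUnion.2 ⟨c, mem_univ c, Fintype.mem_piFinset.2 fun e => by simpa [hP] using hc e⟩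
  have hPc : ∀ c ∈ (univ : Finset (Fin n → Fin 2)),
      ((Fintype.piFinset fun _ : Fin (12 * n) => P c).card : ℝ) ≤
        (7 / 8 * n ^ 4) ^ (12 * n) := by
    intro c _
    rw [Fintype.card_piFinset_const]
    push_cast
    exact pow_le_pow_left₀ (by positivity) (card_filter_proper_le c) _
  calc _ ≤ ((univ.biUnion fun c => Fintype.piFinset fun _ : Fin (12 * n) => P c).card : ℝ) := by
        exact_mod_cast card_le_card hsub
    _ ≤ ∑ c : Fin n → Fin 2, ((Fintype.piFinset fun _ : Fin (12 * n) => P c).card : ℝ) := by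
        exact_mod_cast card_biUnion_le
    _ ≤ ∑ c : Fin n → Fin 2, (7 / 8 * n ^ 4 : ℝ) ^ (12 * n) := sum_le_sum hPc
    _ = (2 * (7 / 8) ^ 12) ^ n * (n ^ 4) ^ (12 * n) := by
        rw [sum_const, card_univ, Fintype.card_fun, Fintype.card_fin, Fintype.card_fin,
          nsmul_eq_mul, mul_pow (7 / 8 : ℝ), mul_pow (2 : ℝ), ← pow_mul (7 / 8 : ℝ)]
        push_cast
        ring
    _ ≤ _ := by
        gcongr
        -- Twelve constraints per vertex are enough to beat the `2 ^ n` colourings.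
        calc (2 * (7 / 8) ^ 12 : ℝ) ^ n ≤ (1 / 2) ^ n := by
              gcongr
              norm_num
          _ ≤ (1 / 2) ^ 1 := pow_le_pow_of_le_one (by norm_num) (by norm_num) hn0
          _ = 1 / 2 := pow_one _

/-- There are expanding instances without a proper colouring. -/
theorem exists_expanding_not_colourable {r : ℕ} (hn0 : 0 < n) (hn : 3 * r * 11664 ^ 4 ≤ n) :
    ∃ E : Fin (12 * n) → Fin 4 → Fin n,
      (∀ F : Finset (Fin (12 * n)), F.Nonempty → F.card ≤ r →
        11 * F.card < 4 * (support E F).card) ∧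
      ∀ c : Fin n → Fin 2, ∃ e, (∀ i, c (E e i) = 0) ∨ ∀ i, c (E e i) = 1 := by
  classical
  have h1 := card_filter_not_expanding_le (r := r) hn0 hn
  have h2 := card_filter_colourable_le hn0
  set B₁ := univ.filter fun E : Fin (12 * n) → Fin 4 → Fin n =>
      ∃ F : Finset (Fin (12 * n)), F.Nonempty ∧ F.card ≤ r ∧
        4 * (support E F).card ≤ 11 * F.card with hB₁
  set B₂ := univ.filter fun E : Fin (12 * n) → Fin 4 → Fin n => ∃ c : Fin n → Fin 2,
      ∀ e, (∃ i, c (E e i) ≠ 0) ∧ ∃ i, c (E e i) ≠ 1 with hB₂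
  have hlt : (B₁ ∪ B₂).card < (univ : Finset (Fin (12 * n) → Fin 4 → Fin n)).card := by
    have h3 : ((B₁ ∪ B₂).card : ℝ) ≤ B₁.card + B₂.card := by exact_mod_cast card_union_le B₁ B₂
    have h4 : (0 : ℝ) < ((n : ℝ) ^ 4) ^ (12 * n) := by positivity
    have h5 : ((univ : Finset (Fin (12 * n) → Fin 4 → Fin n)).card : ℝ) =
        ((n : ℝ) ^ 4) ^ (12 * n) := by simp
    have h6 : ((B₁ ∪ B₂).card : ℝ) < (univ : Finset (Fin (12 * n) → Fin 4 → Fin n)).card := by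
      rw [h5]
      linarith
    exact_mod_cast h6
  obtain ⟨E, -, hE⟩ := exists_mem_notMem_of_card_lt_card hlt
  simp only [hB₁, hB₂, mem_union, mem_filter, mem_univ, true_and, not_or] at hE
  refine ⟨E, fun F hF hFr => ?_, fun c => ?_⟩
  · by_contra hcon
    exact hE.1 ⟨F, hF, hFr, by omega⟩
  · by_contra! hcon
    exact hE.2 ⟨c, hcon⟩

/-! ### The width of the template -/

theorem exists_consistent_not_maps {k : ℕ} (hk : 0 < k) (hn : 12 * k * 11664 ^ 4 ≤ n) :
    ∃ I : RelStructure (singleSig 4), Nat.card I.carrier = n ∧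
      Consistent k I (exactlyIn 2 4) ∧ ¬ Maps I (nae 4) := by
  obtain ⟨E, hE, hc⟩ := exists_expanding_not_colourable (n := n) (r := 4 * k)
    (lt_of_lt_of_le (by positivity) hn) (by rwa [← mul_assoc])
  refine ⟨ofConstraints E, Nat.card_fin n, consistent_ofConstraints hk hE, ?_⟩
  rintro ⟨c, hhom⟩
  obtain ⟨e, he⟩ := hc c
  have := hhom () (E e) ⟨e, rfl⟩
  rcases he with he | he
  · exact this.1 (funext he)
  · exact this.2 (funext he)

theorem not_hasSublinearWidth : ¬ HasSublinearWidth (exactlyIn 2 4) (nae 4) := by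
  rintro ⟨k, hk, hw⟩
  have h := hk.bound (c := 1 / (12 * 11664 ^ 4)) (by positivity)
  obtain ⟨n, hn, hn0⟩ := (h.and (Filter.eventually_ge_atTop (12 * 11664 ^ 4))).exists
  have hkn : 12 * k n * 11664 ^ 4 ≤ n := by
    simp only [Real.norm_natCast] at hn
    have h1 : (12 * k n * 11664 ^ 4 : ℝ) ≤ n := by linarith
    exact_mod_cast h1
  -- The maximum covers `k n = 0`, since the construction needs a positive `k`; a strategy for the
  -- larger number also serves for `k n`.
  obtain ⟨I, hI, hcons, hmaps⟩ := exists_consistent_not_maps (n := n) (k := max 1 (k n))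
    (by omega) (by
      rcases le_total 1 (k n) with h1 | h1
      · rwa [max_eq_right h1]
      · rw [max_eq_left h1, mul_one]
        exact hn0)
  exact hmaps (hw I ((hI ▸ hcons).anti (hI ▸ le_max_right 1 (k n))))

theorem HasBoundedWidth.hasSublinearWidth {σ : Signature} {S T : RelStructure σ}
    (h : HasBoundedWidth S T) : HasSublinearWidth S T := by
  obtain ⟨k, hk, hw⟩ := h
  refine ⟨k, hk.trans_isLittleO ?_, hw⟩
  rw [Asymptotics.isLittleO_const_left]
  right
  exact tendsto_norm_atTop_atTop.comp tendsto_natCast_atTop_atTop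

end PCSP

theorem mainTheorem5 :
    (∃ (σ : PCSP.Signature) (S T : PCSP.RelStructure σ),
      PCSP.IsTemplate S T ∧
      ¬ PCSP.HasSublinearWidth S T ∧ ¬ PCSP.HasBoundedWidth S T ∧
      ∀ m : ℕ, 3 ≤ m → ∃ g ∈ PCSP.Pol S T m, PCSP.IsWNU g) ∧
    (PCSP.IsTemplate (PCSP.exactlyIn 2 4) (PCSP.nae 4) ∧
      ¬ PCSP.HasSublinearWidth (PCSP.exactlyIn 2 4) (PCSP.nae 4) ∧
      ¬ PCSP.HasBoundedWidth (PCSP.exactlyIn 2 4) (PCSP.nae 4) ∧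
      ∀ (m : ℕ) (hm : 3 ≤ m),
        PCSP.majorityOrFirst m (Nat.zero_lt_of_lt hm) ∈
            PCSP.Pol (PCSP.exactlyIn 2 4) (PCSP.nae 4) m ∧
          PCSP.IsWNU
            (PCSP.majorityOrFirst m (Nat.zero_lt_of_lt hm))) := by
  have hT := PCSP.isTemplate_exactlyIn_nae
  have hS := PCSP.not_hasSublinearWidth
  have hB : ¬ PCSP.HasBoundedWidth (PCSP.exactlyIn 2 4) (PCSP.nae 4) :=
    fun h => hS h.hasSublinearWidth
  have hP : ∀ (m : ℕ) (hm : 3 ≤ m),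
      PCSP.majorityOrFirst m (Nat.zero_lt_of_lt hm) ∈
          PCSP.Pol (PCSP.exactlyIn 2 4) (PCSP.nae 4) m ∧
        PCSP.IsWNU (PCSP.majorityOrFirst m (Nat.zero_lt_of_lt hm)) :=
    fun _ hm => ⟨PCSP.majorityOrFirst_mem_pol _, PCSP.isWNU_majorityOrFirst hm _⟩
  exact ⟨⟨_, _, _, hT, hS, hB, fun m hm => ⟨_, hP m hm⟩⟩, hT, hS, hB, hP⟩
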